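/- Let $(M,\mu)$ be a closed weighted Riemannian manifold, i.e. $M$ is a compact connected smooth Riemannian manifold without boundary, with Riemannian distance $d$ and Riemannian volume measure $\mathrm{vol}_M$, and $\mu$ is a Borel probability measure of the form $d\mu=e^{-\psi}\,d\mathrm{vol}_M$ with $\psi\in C^2(M)$. No curvature assumption is made. For a subset $A\subseteq M$ let $O_r(A)$ be its open $r$-neighbourhood, and for Borel $A$ let $$\mu^+(A)=\liminf_{r\to 0^+}\frac{\mu(O_r(A))-\mu(A)}{r}.$$ For an integer $k\ge 1$ define the $k$-way isoperimetric constant $$h_k(M,\mu)=\inf_{A_0,\dots,A_k}\ \max_{0\le i\le k}\frac{\mu^+(A_i)}{\mu(A_i)}\in[0,\infty],$$ where the infimum runs over all families of $k+1$ pairwise disjoint Borel subsets of $M$ of positive measure ($\inf\emptyset=\infty$). For $\kappa_0,\dots,\kappa_k\ge 0$ define the separation distance $$\mathrm{Sep}((M,\mu);\kappa_0,\dots,\kappa_k)=\sup_{A_0,\dots,A_k}\ \min_{i\ne j} d(A_i,A_j),\qquad d(A,B)=\inf_{x\in A,\,y\in B}d(x,y),$$ where the supremum runs over all non-empty Borel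 subsets $A_0,\dots,A_k$ of $M$ with $\mu(A_i)\ge\kappa_i$ for all $i$ ($\sup\emptyset=0$). Then for every integer $k\ge 1$ and every real $\kappa$ with $0<\kappa\le 2$, $$\mathrm{Sep}((M,\mu);\underbrace{\kappa,\dots,\kappa}_{k+1\text{ times}})\ \le\ \frac{2}{\log 2}\cdot\frac{\log(2/\kappa)}{h_k(M,\mu)\,\kappa},$$ with the usual conventions in $[0,\infty]$ for the right-hand side ($c/\infty=0$; $c/0=\infty$ for $c>0$ and $0/0=0$). -/

import Mathlib

open Set Filter Topology MeasureTheory Bundle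
open scoped ENNReal Manifold ContDiff

noncomputable section

namespace WeightedRiemannian

section Volume

variable (n : ℕ) {M : Type*} [TopologicalSpace M] [ChartedSpace (EuclideanSpace ℝ (Fin n)) M]
  [RiemannianBundle (fun x : M => TangentSpace (𝓡 n) x)]

/-- The coordinate vector field `∂ᵢ` of the chart `e`, at the point of `M` whose coordinates
are `y`. -/
def coordVector (e : OpenPartialHomeomorph M (EuclideanSpace ℝ (Fin n)))
    (y : EuclideanSpace ℝ (Fin n)) (i : Fin n) : TangentSpace (𝓡 n) (e.symm y) :=
  mfderiv (𝓡 n) (𝓡 n) e.symm y (EuclideanSpace.single i (1 : ℝ) : EuclideanSpace ℝ (Fin n))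

/-- The matrix `g_{ij} = ⟨∂ᵢ, ∂ⱼ⟩` of the Riemannian metric in the chart `e`. -/
def gramMatrix (e : OpenPartialHomeomorph M (EuclideanSpace ℝ (Fin n)))
    (y : EuclideanSpace ℝ (Fin n)) : Matrix (Fin n) (Fin n) ℝ :=
  Matrix.of fun i j => inner ℝ (coordVector n e y i) (coordVector n e y j)

/-- The Riemannian volume of the domain of the chart `e`, as a measure on `M`: the image under
`e⁻¹` of the measure `√det(g_{ij}) dy` on the open set `e.target`. -/
def chartVolume [MeasurableSpace M] (e : OpenPartialHomeomorph M (EuclideanSpace ℝ (Fin n))) :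
    Measure M :=
  Measure.map e.symm
    ((volume.restrict e.target).withDensity
      fun y => ENNReal.ofReal (Real.sqrt (gramMatrix n e y).det))

/-- The Riemannian volume measure. The local measures `chartVolume` agree on the overlaps of the
charts, by the change of variables formula, so their supremum in the lattice of measures is the
measure on `M` that restricts to each of them on the domain of the chart. -/
def riemannianVolume (M : Type*) [TopologicalSpace M]
    [ChartedSpace (EuclideanSpace ℝ (Fin n)) M]
    [RiemannianBundle (fun x : M => TangentSpace (𝓡 n) x)] [MeasurableSpace M] : Measure M :=
  ⨆ e ∈ atlas (EuclideanSpace ℝ (Fin n)) M, chartVolume n e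

/-- The weighted measure `exp(-ψ) dvol`. -/
def weightedMeasure [MeasurableSpace M] (ψ : M → ℝ) : Measure M :=
  (riemannianVolume n M).withDensity fun x => ENNReal.ofReal (Real.exp (-ψ x))

end Volume

section MetricMeasure

variable {X : Type*} [MetricSpace X] [MeasurableSpace X]

/-- Minkowski's exterior boundary measure
`μ⁺(A) = liminf_{r → 0⁺} (μ(O_r(A)) - μ(A)) / r`, with `O_r(A)` the open `r`-neighbourhood. -/
def boundaryMeasure (μ : Measure X) (A : Set X) : ℝ≥0∞ :=
  liminf (fun r : ℝ => (μ (Metric.thickening r A) - μ A) / ENNReal.ofReal r) (𝓝[>] 0)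

/-- The `k`-way isoperimetric constant: the infimum of `max_i μ⁺(A_i) / μ(A_i)` over all families
of `k + 1` disjoint Borel sets (of positive measure, so that the quotients make sense). -/
def isoperimetricConstant (μ : Measure X) (k : ℕ) : ℝ≥0∞ :=
  ⨅ (A : Fin (k + 1) → Set X) (_ : ∀ i, MeasurableSet (A i)) (_ : ∀ i, 0 < μ (A i))
    (_ : ∀ i j, i ≠ j → Disjoint (A i) (A j)),
    ⨆ i, boundaryMeasure μ (A i) / μ (A i)

/-- The distance `inf {d(x, y) | x ∈ A, y ∈ B}` between two sets. -/
def setDist (A B : Set X) : ℝ≥0∞ :=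
  ⨅ (x ∈ A) (y ∈ B), edist x y

/-- The separation distance `Sep(X; κ_0, …, κ_k)`: the supremum of `min_{i ≠ j} d(A_i, A_j)` over
all Borel sets `A_0, …, A_k` with `μ(A_i) ≥ κ_i` (non-empty, which is automatic if `κ_i > 0`). -/
def separationDistance (μ : Measure X) {k : ℕ} (κ : Fin (k + 1) → ℝ) : ℝ≥0∞ :=
  ⨆ (A : Fin (k + 1) → Set X) (_ : ∀ i, MeasurableSet (A i)) (_ : ∀ i, (A i).Nonempty)
    (_ : ∀ i, ENNReal.ofReal (κ i) ≤ μ (A i)),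
    ⨅ (i) (j) (_ : i ≠ j), setDist (A i) (A j)

end MetricMeasure

end WeightedRiemannian

end

/-!
The inequality holds for every probability measure on a metric space. Let `A₀, …, A_k` be sets of
measure at least `κ` at pairwise distance more than `δ`. For `0 < r ≤ δ / 2` the open
neighbourhoods `O_r(A_i)` are disjoint, so one of them satisfies
`μ⁺(O_r(A_i)) ≥ h_k μ(O_r(A_i)) ≥ h_k κ`. As `O_s(O_r(A)) ⊆ O_{r+s}(A)`, the lower right
derivative of the total volume `S(r) = ∑ i, μ(O_r(A_i))` at `r` is at least `h_k κ`
(`eventually_add_mul_le_totalVolume`). A monotone function grows at least as fast as a lower bound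
for its lower right derivative (`MonotoneOn.mul_sub_le_sub_of_frequently`), and `S ≤ 1` by
disjointness, so that `h_k κ δ ≤ 2` (`isoperimetricConstant_mul_le_two`). This is stronger than
the claim, because `log (2 / κ) ≥ log 2` when `κ ≤ 1`, and for `κ > 1` there are no
sets of measure `κ`.
-/

/-- A monotone function whose right difference quotients at every point of `[a, b)` are at least
`c` for arbitrarily small steps grows by at least `c (b - a)`. No continuity is needed, since
a monotone function has only upward jumps. -/
theorem MonotoneOn.mul_sub_le_sub_of_frequently {f : ℝ → ℝ} {a b c : ℝ} (hab : a ≤ b)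
    (hf : MonotoneOn f (Icc a b))
    (h : ∀ r ∈ Ico a b, ∃ᶠ s in 𝓝[>] (0 : ℝ), f r + c * s ≤ f (r + s)) :
    c * (b - a) ≤ f b - f a := by
  let T : Set ℝ := {t ∈ Icc a b | c * (t - a) ≤ f t - f a}
  have haT : a ∈ T := ⟨left_mem_Icc.2 hab, by simp⟩
  have hTb : BddAbove T := ⟨b, fun t ht => ht.1.2⟩
  have hsup : sSup T ∈ Icc a b := ⟨le_csSup hTb haT, csSup_le ⟨a, haT⟩ fun t ht => ht.1.2⟩
  have hmem : sSup T ∈ T := by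
    refine ⟨hsup, ?_⟩
    -- Points of `T` approximate the supremum from below; monotonicity passes to the limit.
    obtain ⟨u, -, hu, huT⟩ := exists_seq_tendsto_sSup ⟨a, haT⟩ hTb
    have hlim : Tendsto (fun m => c * (u m - a)) atTop (𝓝 (c * (sSup T - a))) :=
      (hu.sub_const a).const_mul c
    refine le_of_tendsto' hlim fun m => (huT m).2.trans ?_
    exact sub_le_sub_right (hf (huT m).1 hsup (le_csSup hTb (huT m))) _
  rcases hsup.2.eq_or_lt with heq | hlt
  · have := hmem.2
    rwa [heq] at this
  · exfalso
    have hsmall : ∀ᶠ s in 𝓝[>] (0 : ℝ), s ∈ Ioo 0 (b - sSup T) :=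
      Ioo_mem_nhdsGT (sub_pos.2 hlt)
    obtain ⟨s, hs, hs0, hsb⟩ := ((h _ ⟨hsup.1, hlt⟩).and_eventually hsmall).exists
    have hT : sSup T + s ∈ T := by
      refine ⟨⟨by linarith [hsup.1], by linarith⟩, ?_⟩
      have := hmem.2
      linarith
    linarith [le_csSup hTb hT]

namespace WeightedRiemannian

theorem disjoint_thickening_of_le_setDist {X : Type*} [MetricSpace X] {A B : Set X} {r : ℝ}
    (h : ENNReal.ofReal (2 * r) ≤ setDist A B) :
    Disjoint (Metric.thickening r A) (Metric.thickening r B) := by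
  refine Set.disjoint_left.2 fun z hzA hzB => ?_
  obtain ⟨x, hx, hzx⟩ := Metric.mem_thickening_iff.1 hzA
  obtain ⟨y, hy, hzy⟩ := Metric.mem_thickening_iff.1 hzB
  have h1 : ENNReal.ofReal (2 * r) ≤ edist x y := h.trans (iInf₂_le_of_le x hx (iInf₂_le y hy))
  rw [edist_dist, ENNReal.ofReal_le_ofReal_iff dist_nonneg] at h1
  linarith [dist_triangle_left x y z]

variable {X : Type*} [MetricSpace X] [MeasurableSpace X]

/-- The total volume `∑ i, μ(O_r(A_i))` of the open `r`-neighbourhoods of a family of sets. -/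
def totalVolume (μ : Measure X) {ι : Type*} [Fintype ι] (A : ι → Set X) (r : ℝ) : ℝ :=
  ∑ i, μ.real (Metric.thickening r (A i))

theorem monotone_totalVolume (μ : Measure X) [IsFiniteMeasure μ] {ι : Type*} [Fintype ι]
    (A : ι → Set X) : Monotone (totalVolume μ A) := fun _ _ hrs =>
  Finset.sum_le_sum fun i _ => measureReal_mono (Metric.thickening_mono hrs (A i))

theorem totalVolume_nonneg (μ : Measure X) {ι : Type*} [Fintype ι] (A : ι → Set X) (r : ℝ) :
    0 ≤ totalVolume μ A r :=
  Finset.sum_nonneg fun _ _ => measureReal_nonneg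

theorem totalVolume_le_one [BorelSpace X] (μ : Measure X) [IsProbabilityMeasure μ] {ι : Type*}
    [Fintype ι] (A : ι → Set X) {r : ℝ}
    (h : ∀ i j, i ≠ j → ENNReal.ofReal (2 * r) ≤ setDist (A i) (A j)) :
    totalVolume μ A r ≤ 1 := by
  rw [totalVolume, ← measureReal_iUnion_fintype
    (fun i j hij => disjoint_thickening_of_le_setDist (h i j hij))
    (fun i => Metric.isOpen_thickening.measurableSet)]
  exact measureReal_le_one

/-- If `L < h_k`, then one of the disjoint neighbourhoods `O_r(A_i)` has boundary measure more
than `L μ(O_r(A_i))`; so the total volume grows at rate at least `L κ` at `r`. -/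
theorem eventually_add_mul_le_totalVolume [BorelSpace X] (μ : Measure X) [IsFiniteMeasure μ]
    {k : ℕ} {A : Fin (k + 1) → Set X} {κ : ℝ} (hκ : 0 < κ)
    (hA : ∀ i, ENNReal.ofReal κ ≤ μ (A i)) {L : ℝ} (hL : 0 ≤ L)
    (hLh : ENNReal.ofReal L < isoperimetricConstant μ k) {r : ℝ} (hr : 0 < r)
    (hd : ∀ i j, i ≠ j → ENNReal.ofReal (2 * r) ≤ setDist (A i) (A j)) :
    ∀ᶠ s in 𝓝[>] (0 : ℝ), totalVolume μ A r + L * κ * s ≤ totalVolume μ A (r + s) := by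
  have hge : ∀ i, ENNReal.ofReal κ ≤ μ (Metric.thickening r (A i)) := fun i =>
    (hA i).trans (measure_mono (Metric.self_subset_thickening hr _))
  have hpos : ∀ i, 0 < μ (Metric.thickening r (A i)) := fun i =>
    (ENNReal.ofReal_pos.2 hκ).trans_le (hge i)
  have hlt : ENNReal.ofReal L < ⨆ i, boundaryMeasure μ (Metric.thickening r (A i)) /
      μ (Metric.thickening r (A i)) :=
    hLh.trans_le <| iInf₂_le_of_le (fun i => Metric.thickening r (A i))
      (fun i => Metric.isOpen_thickening.measurableSet) <|
      iInf₂_le hpos fun i j hij => disjoint_thickening_of_le_setDist (hd i j hij)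
  obtain ⟨i, hi⟩ := lt_iSup_iff.1 hlt
  rw [ENNReal.lt_div_iff_mul_lt (Or.inl (hpos i).ne') (Or.inl (measure_ne_top _ _))] at hi
  filter_upwards [eventually_lt_of_lt_liminf hi, self_mem_nhdsWithin] with s hs hs0
  have hs0 : 0 < s := hs0
  rw [ENNReal.lt_div_iff_mul_lt (Or.inl (ENNReal.ofReal_pos.2 hs0).ne')
    (Or.inl ENNReal.ofReal_ne_top)] at hs
  have hstep : μ.real (Metric.thickening r (A i)) + L * κ * s ≤
      μ.real (Metric.thickening (r + s) (A i)) := by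
    have h1 : ENNReal.ofReal (L * κ * s) ≤ μ (Metric.thickening (r + s) (A i)) -
        μ (Metric.thickening r (A i)) := by
      rw [ENNReal.ofReal_mul (by positivity), ENNReal.ofReal_mul hL]
      calc ENNReal.ofReal L * ENNReal.ofReal κ * ENNReal.ofReal s
          ≤ ENNReal.ofReal L * μ (Metric.thickening r (A i)) * ENNReal.ofReal s := by
            gcongr
            exact hge i
        _ ≤ μ (Metric.thickening s (Metric.thickening r (A i))) -
            μ (Metric.thickening r (A i)) := hs.le
        _ ≤ _ := by
            refine tsub_le_tsub_right (measure_mono ?_) _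
            rw [add_comm]
            exact Metric.thickening_thickening_subset s r (A i)
    have hmono : μ (Metric.thickening r (A i)) ≤ μ (Metric.thickening (r + s) (A i)) :=
      measure_mono (Metric.thickening_mono (by linarith) _)
    have h2 := (ENNReal.ofReal_le_iff_le_toReal
      (ENNReal.sub_ne_top (measure_ne_top _ _))).1 h1
    rw [ENNReal.toReal_sub_of_le hmono (measure_ne_top _ _)] at h2
    simp only [Measure.real]
    linarith
  rw [totalVolume, totalVolume, ← Finset.add_sum_erase _ _ (Finset.mem_univ i),
    ← Finset.add_sum_erase Finset.univ (fun j => μ.real (Metric.thickening (r + s) (A j)))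
      (Finset.mem_univ i)]
  have hrest : ∑ j ∈ Finset.univ.erase i, μ.real (Metric.thickening r (A j)) ≤
      ∑ j ∈ Finset.univ.erase i, μ.real (Metric.thickening (r + s) (A j)) :=
    Finset.sum_le_sum fun j _ => measureReal_mono (Metric.thickening_mono (by linarith) _)
  linarith

/-- The separation inequality `h_k κ min_{i ≠ j} d(A_i, A_j) ≤ 2`, valid in every metric
probability space. -/
theorem isoperimetricConstant_mul_le_two [BorelSpace X] (μ : Measure X) [IsProbabilityMeasure μ]
    {k : ℕ} {A : Fin (k + 1) → Set X} {κ : ℝ} (hκ : 0 < κ)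
    (hA : ∀ i, ENNReal.ofReal κ ≤ μ (A i)) :
    (⨅ (i) (j) (_ : i ≠ j), setDist (A i) (A j)) *
      (isoperimetricConstant μ k * ENNReal.ofReal κ) ≤ 2 := by
  suffices h : (⨅ (i) (j) (_ : i ≠ j), setDist (A i) (A j)) * isoperimetricConstant μ k ≤
      ENNReal.ofReal (2 / κ) by
    calc _ = (⨅ (i) (j) (_ : i ≠ j), setDist (A i) (A j)) * isoperimetricConstant μ k *
          ENNReal.ofReal κ := (mul_assoc _ _ _).symm
      _ ≤ ENNReal.ofReal (2 / κ) * ENNReal.ofReal κ := mul_le_mul_left h _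
      _ = 2 := by
        rw [← ENNReal.ofReal_mul (by positivity), div_mul_cancel₀ _ hκ.ne', ENNReal.ofReal_ofNat]
  -- Finite lower bounds `δ` and `L` of the two factors suffice, even if a factor is `∞`.
  refine ENNReal.mul_le_of_forall_lt fun δ hδ L hL => ?_
  lift δ to NNReal using hδ.ne_top
  lift L to NNReal using hL.ne_top
  rw [← ENNReal.coe_mul, ← ENNReal.ofReal_coe_nnreal, NNReal.coe_mul]
  refine ENNReal.ofReal_le_ofReal ?_
  rw [le_div_iff₀ hκ]
  rw [← ENNReal.ofReal_coe_nnreal] at hδ hL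
  have hd : ∀ r : ℝ, r ≤ δ / 2 → ∀ i j, i ≠ j →
      ENNReal.ofReal (2 * r) ≤ setDist (A i) (A j) := fun r hr i j hij =>
    (ENNReal.ofReal_le_ofReal (by linarith)).trans <| hδ.le.trans <|
      iInf₂_le_of_le i j (iInf_le _ hij)
  -- The neighbourhood of radius `0` is empty, so the growth is measured from a radius `a > 0`.
  have hgrowth : ∀ a : ℝ, 0 < a → a ≤ δ / 2 → L * κ * (δ / 2 - a) ≤ 1 := fun a ha hab => by
    have h1 := MonotoneOn.mul_sub_le_sub_of_frequently (c := L * κ) hab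
      ((monotone_totalVolume μ A).monotoneOn _) fun r hr =>
        (eventually_add_mul_le_totalVolume μ hκ hA L.2 hL (ha.trans_le hr.1)
          (hd r hr.2.le)).frequently
    linarith [totalVolume_nonneg μ A a, totalVolume_le_one μ A (hd (δ / 2) le_rfl)]
  have hδ0 : (0 : ℝ) ≤ δ := δ.2
  rcases hδ0.eq_or_lt with h0 | hpos
  · simp [← h0]
  · have hlim : Tendsto (fun a : ℝ => L * κ * (δ / 2 - a)) (𝓝[>] 0) (𝓝 (L * κ * (δ / 2 - 0))) :=
      (by fun_prop : Continuous fun a : ℝ => L * κ * (δ / 2 - a)).continuousWithinAt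
    have hle : L * κ * (δ / 2 - 0) ≤ 1 := by
      refine le_of_tendsto hlim ?_
      filter_upwards [Ioo_mem_nhdsGT (half_pos hpos)] with a ha
      exact hgrowth a ha.1 ha.2.le
    linarith

theorem separationDistance_le [BorelSpace X] (μ : Measure X) [IsProbabilityMeasure μ] (k : ℕ)
    {κ : ℝ} (hκ : 0 < κ) :
    separationDistance μ (fun _ : Fin (k + 1) => κ) ≤
      ENNReal.ofReal (2 / Real.log 2) * (ENNReal.ofReal (Real.log (2 / κ)) /
        (isoperimetricConstant μ k * ENNReal.ofReal κ)) := by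
  refine iSup₂_le fun A _ => iSup₂_le fun _ hA => ?_
  have hκ1 : κ ≤ 1 := by
    have := (hA 0).trans prob_le_one
    rwa [ENNReal.ofReal_le_one] at this
  have hlog2 : 0 < Real.log 2 := Real.log_pos one_lt_two
  have hconst : (2 : ℝ≥0∞) ≤
      ENNReal.ofReal (2 / Real.log 2) * ENNReal.ofReal (Real.log (2 / κ)) := by
    rw [← ENNReal.ofReal_mul (by positivity), ← ENNReal.ofReal_ofNat]
    refine ENNReal.ofReal_le_ofReal ?_
    rw [div_mul_eq_mul_div, le_div_iff₀ hlog2]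
    gcongr
    rw [le_div_iff₀ hκ]
    linarith
  rw [← mul_div_assoc]
  refine le_trans ?_ (ENNReal.div_le_div_right hconst _)
  rw [ENNReal.le_div_iff_mul_le (Or.inr two_ne_zero) (Or.inr ENNReal.ofNat_ne_top)]
  exact isoperimetricConstant_mul_le_two μ hκ hA

end WeightedRiemannian

theorem mainTheorem9 (n : ℕ) {M : Type*} [MetricSpace M] [CompactSpace M] [ConnectedSpace M]
    [ChartedSpace (EuclideanSpace ℝ (Fin n)) M] [IsManifold (𝓡 n) ∞ M]
    [RiemannianBundle (fun x : M => TangentSpace (𝓡 n) x)]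
    [IsContMDiffRiemannianBundle (𝓡 n) ∞ (EuclideanSpace ℝ (Fin n))
      (fun x : M => TangentSpace (𝓡 n) x)]
    [IsRiemannianManifold (𝓡 n) M]
    [MeasurableSpace M] [BorelSpace M]
    (ψ : M → ℝ) (hψ : ContMDiff (𝓡 n) 𝓘(ℝ, ℝ) 2 ψ)
    (μ : Measure M) (hμ : μ = WeightedRiemannian.weightedMeasure n ψ) [IsProbabilityMeasure μ]
    (k : ℕ) (hk : 1 ≤ k) (κ : ℝ) (hκ : 0 < κ) (hκ' : κ ≤ 2) :
    WeightedRiemannian.separationDistance μ (fun _ : Fin (k + 1) => κ) ≤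
      ENNReal.ofReal (2 / Real.log 2) *
        (ENNReal.ofReal (Real.log (2 / κ)) /
          (WeightedRiemannian.isoperimetricConstant μ k * ENNReal.ofReal κ)) :=
  WeightedRiemannian.separationDistance_le μ k hκ
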